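/- Let $R$ be an associative ring with identity. Call $R$ left $\aleph_0$-injective if every homomorphism of left $R$-modules from a countably generated left ideal of $R$ to ${}_RR$ extends to a homomorphism ${}_RR\to{}_RR$. If $R$ is right noetherian and left $\aleph_0$-injective, then $R$ is quasi-Frobenius; that is, $R$ is left and right noetherian and left and right self-injective. -/

import Mathlib

/-- A ring `R` is left `ℵ₀`-injective if every left `R`-linear map from a countably generated
left ideal of `R` to `R` extends to a left `R`-linear map `R → R`.
(For a noncommutative ring, `Ideal R` is the type of left ideals.) -/
def IsLeftAlephZeroInjective (R : Type*) [Ring R] : Prop :=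
  ∀ I : Ideal R, (∃ s : Set R, s.Countable ∧ Ideal.span s = I) →
    ∀ f : I →ₗ[R] R, ∃ g : R →ₗ[R] R, ∀ x : I, g x = f x

/-- A ring `R` is quasi-Frobenius if it is noetherian and self-injective, on both sides.
The right module `R_R` is `R` as a module over `Rᵐᵒᵖ`. -/
structure IsQuasiFrobenius (R : Type*) [Ring R] : Prop where
  left_noetherian : IsNoetherian R R
  right_noetherian : IsNoetherian Rᵐᵒᵖ R
  left_selfInjective : Module.Injective R R
  right_selfInjective : Module.Injective Rᵐᵒᵖ R

/-!
Write `Z` for the left singular ideal, the set of elements with essential left annihilator.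

The proof first shows that `R` is right artinian. If `R x₀ ⊕ R x₁ ⊕ ⋯` were an infinite direct sum
of nonzero left ideals, then, the projections being right multiplications, the right annihilators
of its tails would form a strictly increasing chain of right ideals
(`not_forall_disjoint_span`). This is where countably generated left ideals are needed. So essential
complements of left ideals can be chosen finitely generated, and Utumi's argument shows that `R / Z`
is von Neumann regular (`exists_sub_mem_leftSingular`); being right noetherian, it is semisimple.
Moreover `Z` is nilpotent (`isNilpotent_leftSingular`), because its powers are finitely generated as
right ideals while their left annihilators are essential. Hence `R` is semiprimary as well as right
noetherian, and the Hopkins–Levitzki theorem applies.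

In a right artinian ring the right annihilator of a left ideal is already that of a finitely
generated part of it, so that every map from a left ideal to `R` is a right multiplication
(`IsLeftAlephZeroInjective.mapsAreRightMul_of_isArtinianRing`): `R` is left self-injective.
It follows that every right ideal is a right annihilator (`rightAnn_leftAnn`).

For left ideals the same is deduced from the fact that every simple left module embeds in `R`,
that is, that the right annihilator `S` of `Z` (the left socle) is a faithful left module over the
semisimple ring `R / Z` (`leftAnnRight_rightAnnLeft_leftSingular`). As a right module `S` is
faithful; the two sides are compared through the map sending a right ideal `I ⊇ Z` to the right
annihilator of the right annihilator of `I`, by an argument like the one which shows that a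
surjective endomorphism of a noetherian module is injective. With both double annihilator
conditions, the left ideals satisfy the ascending chain condition, and right self-injectivity is
the theorem of Ikeda and Nakayama (`baer_op`).
-/

open MulOpposite

/-! ### Annihilators, essential left ideals, extension of maps -/

/-- The right annihilator of a set, as a right ideal. Right ideals of `R` are encoded throughout
as elements of `Ideal Rᵐᵒᵖ`. -/
def rightAnn {R : Type*} [Ring R] (s : Set R) : Ideal Rᵐᵒᵖ where
  carrier := {x | ∀ a ∈ s, a * unop x = 0}
  add_mem' hx hy a ha := by rw [unop_add, mul_add, hx a ha, hy a ha, add_zero]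
  zero_mem' a _ := by simp
  smul_mem' c x hx a ha := by rw [smul_eq_mul, unop_mul, ← mul_assoc, hx a ha, zero_mul]

/-- The left annihilator, as a left ideal, of a set given in the opposite ring. -/
def leftAnn {R : Type*} [Ring R] (s : Set Rᵐᵒᵖ) : Ideal R where
  carrier := {y | ∀ x ∈ s, y * unop x = 0}
  add_mem' hx hy a ha := by rw [add_mul, hx a ha, hy a ha, add_zero]
  zero_mem' a _ := by simp
  smul_mem' c x hx a ha := by rw [smul_eq_mul, mul_assoc, hx a ha, mul_zero]

/-- A left ideal `A` is essential if every nonzero element has a nonzero left multiple in `A`. -/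
def LeftEssential {R : Type*} [Ring R] (A : Ideal R) : Prop :=
  ∀ x : R, x ≠ 0 → ∃ r : R, r * x ≠ 0 ∧ r * x ∈ A

/-- Every left linear map from the left ideal `A` to `R` is a right multiplication. -/
def MapsAreRightMul {R : Type*} [Ring R] (A : Ideal R) : Prop :=
  ∀ f : A →ₗ[R] R, ∃ c : R, ∀ a : A, f a = a * c

section

variable {R : Type*} [Ring R]

theorem mem_leftAnn {s : Set Rᵐᵒᵖ} {y : R} : y ∈ leftAnn s ↔ ∀ x ∈ s, y * unop x = 0 := Iff.rfl

theorem rightAnn_anti {s t : Set R} (h : s ⊆ t) : rightAnn t ≤ rightAnn s :=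
  fun _ hx a ha => hx a (h ha)

theorem leftAnn_anti {s t : Set Rᵐᵒᵖ} (h : s ⊆ t) : leftAnn t ≤ leftAnn s :=
  fun _ hx a ha => hx a (h ha)

theorem rightAnn_span (s : Set R) : rightAnn (Ideal.span s : Set R) = rightAnn s := by
  refine le_antisymm (rightAnn_anti Ideal.subset_span) fun x hx a ha => ?_
  have : Ideal.span s ≤ leftAnn {x} :=
    Ideal.span_le.2 fun b hb y hy => by rw [Set.mem_singleton_iff.1 hy]; exact hx b hb
  exact this ha x rfl

theorem leftAnn_span (s : Set Rᵐᵒᵖ) : leftAnn (Ideal.span s : Set Rᵐᵒᵖ) = leftAnn s := by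
  refine le_antisymm (leftAnn_anti Ideal.subset_span) fun x hx a ha => ?_
  have : Ideal.span s ≤ rightAnn {x} :=
    Ideal.span_le.2 fun b hb y hy => by rw [Set.mem_singleton_iff.1 hy]; exact hx b hb
  exact this ha x rfl

theorem LeftEssential.mono {A B : Ideal R} (hA : LeftEssential A) (h : A ≤ B) :
    LeftEssential B := fun x hx =>
  let ⟨r, hr, hm⟩ := hA x hx
  ⟨r, hr, h hm⟩

theorem LeftEssential.inf {A B : Ideal R} (hA : LeftEssential A) (hB : LeftEssential B) :
    LeftEssential (A ⊓ B) := fun x hx => by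
  obtain ⟨r, hr, hm⟩ := hA x hx
  obtain ⟨s, hs, hm'⟩ := hB _ hr
  rw [← mul_assoc] at hs hm'
  exact ⟨s * r, hs, by rw [mul_assoc]; exact A.mul_mem_left s hm, hm'⟩

/-- An essential left ideal is essential in every finite power of `R`: a finite family that is not
identically zero has a left multiple with all entries in the ideal and some entry nonzero. -/
theorem LeftEssential.exists_mul_finset {A : Ideal R} (hA : LeftEssential A) (F : Finset R)
    {x : R} (hxF : x ∈ F) (hx : x ≠ 0) : ∃ r : R, (∀ y ∈ F, r * y ∈ A) ∧ ∃ y ∈ F, r * y ≠ 0 := by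
  classical
  suffices h : ∀ G : Finset R, G ⊆ F → ∃ r : R, (∀ y ∈ G, r * y ∈ A) ∧ ∃ y ∈ F, r * y ≠ 0 from
    h F subset_rfl
  intro G
  induction G using Finset.induction_on with
  | empty => exact fun _ => ⟨1, by simp, x, hxF, by simpa⟩
  | insert g G _ ih =>
    intro hG
    obtain ⟨r, hr, y, hy, hry⟩ := ih ((Finset.subset_insert g G).trans hG)
    by_cases hg : r * g ∈ A
    · exact ⟨r, by simpa [hg] using hr, y, hy, hry⟩
    · have h0 : r * g ≠ 0 := fun h => hg (h ▸ A.zero_mem)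
      obtain ⟨s, hs, hm⟩ := hA _ h0
      refine ⟨s * r, fun z hz => ?_, g, hG (Finset.mem_insert_self g G), by rwa [mul_assoc]⟩
      rcases Finset.mem_insert.1 hz with rfl | hz
      · rwa [mul_assoc]
      · rw [mul_assoc]; exact A.mul_mem_left s (hr z hz)

theorem IsLeftAlephZeroInjective.mapsAreRightMul (hinj : IsLeftAlephZeroInjective R)
    {s : Set R} (hs : s.Countable) : MapsAreRightMul (Ideal.span s) := fun f => by
  obtain ⟨g, hg⟩ := hinj _ ⟨s, hs, rfl⟩ f
  refine ⟨g 1, fun a => ?_⟩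
  rw [← hg a, ← smul_eq_mul, ← map_smul, smul_eq_mul, mul_one]

theorem IsLeftAlephZeroInjective.mapsAreRightMul_of_fg (hinj : IsLeftAlephZeroInjective R)
    {A : Ideal R} (hA : A.FG) : MapsAreRightMul A := by
  obtain ⟨s, rfl⟩ := hA
  exact hinj.mapsAreRightMul s.countable_toSet

/-- The form in which injectivity is used: if `v` factors through `u`, and maps from the image of
`u` are right multiplications, then `v` is `u` followed by a right multiplication. -/
theorem MapsAreRightMul.exists_eq_mul {M : Type*} [AddCommGroup M] [Module R M]
    {u v : M →ₗ[R] R} (hA : MapsAreRightMul (LinearMap.range u))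
    (h : ∀ m, u m = 0 → v m = 0) : ∃ c : R, ∀ m, v m = u m * c := by
  obtain ⟨c, hc⟩ := hA ((LinearMap.ker u).liftQ v (fun m hm => h m hm) ∘ₗ
    u.quotKerEquivRange.symm.toLinearMap)
  refine ⟨c, fun m => ?_⟩
  have hm : u.quotKerEquivRange.symm ⟨u m, m, rfl⟩ = (LinearMap.ker u).mkQ m := by
    rw [LinearEquiv.symm_apply_eq]; rfl
  rw [← hc ⟨u m, m, rfl⟩, LinearMap.comp_apply, LinearEquiv.coe_coe, hm]
  rfl

/-- Gluing: `a ↦ 0` on `A` and `b ↦ b * x` on `B` agree on `A ⊓ B`, so they define a map on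
`A ⊔ B`. -/
theorem MapsAreRightMul.rightAnn_inf_le {A B : Ideal R} (h : MapsAreRightMul (A ⊔ B)) :
    rightAnn (A ⊓ B : Ideal R) ≤ rightAnn (A : Set R) ⊔ rightAnn (B : Set R) := by
  intro x hx
  let u : (A × B) →ₗ[R] R := A.subtype.coprod B.subtype
  let v : (A × B) →ₗ[R] R := LinearMap.toSpanSingleton R R (unop x) ∘ₗ B.subtype ∘ₗ
    LinearMap.snd R A B
  have hr : LinearMap.range u = A ⊔ B := by simp [u, LinearMap.range_coprod]
  obtain ⟨c, hc⟩ := MapsAreRightMul.exists_eq_mul (u := u) (v := v) (hr ▸ h) (by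
    rintro ⟨a, b⟩ hab
    have hab : (a : R) + b = 0 := hab
    have : (b : R) ∈ A := by
      rw [← neg_eq_of_add_eq_zero_right hab]; exact A.neg_mem a.2
    exact hx b ⟨this, b.2⟩)
  have h1 : ∀ a ∈ A, a * c = 0 := fun a ha => by simpa [u, v] using (hc (⟨a, ha⟩, 0)).symm
  have h2 : ∀ b ∈ B, b * unop x = b * c := fun b hb => by simpa [u, v] using hc (0, ⟨b, hb⟩)
  refine Submodule.mem_sup.2 ⟨op c, h1, x - op c, fun b hb => ?_, by simp⟩
  rw [unop_sub, unop_op, mul_sub, h2 b hb, sub_self]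

/-! ### Direct sums of left ideals -/

/-- A right noetherian left `ℵ₀`-injective ring has no infinite direct sum of nonzero left
ideals: the right annihilators of the tails of the sum would increase strictly. -/
theorem not_forall_disjoint_span [IsNoetherianRing Rᵐᵒᵖ] (hinj : IsLeftAlephZeroInjective R)
    (x : ℕ → R) (hx : ∀ n, x n ≠ 0) :
    ¬ ∀ n, Disjoint (Ideal.span (x '' Set.Iio n)) (Ideal.span {x n}) := by
  classical
  intro hd
  have hfin : ∀ n k, Disjoint (Ideal.span (x '' Set.Iio n))
      (Ideal.span (x '' Set.Ico n (n + k))) := by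
    intro n k
    induction k with
    | zero => simp
    | succ k ih =>
      have e1 : Set.Ico n (n + (k + 1)) = Set.Ico n (n + k) ∪ {n + k} := by
        ext i; simp only [Set.mem_Ico, Set.mem_union, Set.mem_singleton_iff]; omega
      have e2 : Set.Iio n ∪ Set.Ico n (n + k) = Set.Iio (n + k) := by
        ext i; simp only [Set.mem_Ico, Set.mem_union, Set.mem_Iio]; omega
      rw [e1, Set.image_union, Ideal.span_union, Set.image_singleton]
      refine Disjoint.disjoint_sup_right_of_disjoint_sup_left ih ?_
      rw [← Ideal.span_union, ← Set.image_union, e2]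
      exact hd _
  have htail : ∀ n, Disjoint (Ideal.span {x n}) (Ideal.span (x '' Set.Ici (n + 1))) := by
    intro n
    rw [Submodule.disjoint_def]
    intro y hy hy'
    obtain ⟨T, hT, hyT⟩ := Submodule.mem_span_finite_of_mem_span hy'
    obtain ⟨G, hG, rfl⟩ := Finset.subset_set_image_iff.1 hT
    refine Submodule.disjoint_def.1 (hfin (n + 1) (G.sup id + 1)) y
      (Ideal.span_mono (Set.singleton_subset_iff.2
        (Set.mem_image_of_mem x (Set.mem_Iio.2 n.lt_succ_self))) hy) (Submodule.span_mono ?_ hyT)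
    rw [Finset.coe_image]
    refine Set.image_mono fun i hi => ⟨hG hi, ?_⟩
    have : i ≤ G.sup id := Finset.le_sup (f := id) hi
    omega
  let I : ℕ →o Ideal Rᵐᵒᵖ := ⟨fun n => rightAnn (x '' Set.Ici n), fun m n h =>
    rightAnn_anti (Set.image_mono (Set.Ici_subset_Ici.2 h))⟩
  obtain ⟨n, hn⟩ := monotone_stabilizes_iff_noetherian.2 ‹IsNoetherianRing Rᵐᵒᵖ› I
  have hmul : MapsAreRightMul (Ideal.span {x n} ⊔ Ideal.span (x '' Set.Ici (n + 1))) := by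
    rw [← Ideal.span_union]
    exact hinj.mapsAreRightMul ((Set.countable_singleton _).union
      ((Set.to_countable _).image _))
  have h1 : (op 1 : Rᵐᵒᵖ) ∈ rightAnn ((Ideal.span {x n} ⊓
      Ideal.span (x '' Set.Ici (n + 1)) : Ideal R) : Set R) := by
    rw [(htail n).eq_bot]; intro a ha; simpa using ha
  obtain ⟨p, hp, q, hq, hpq⟩ := Submodule.mem_sup.1 (hmul.rightAnn_inf_le h1)
  rw [rightAnn_span] at hp hq
  have hq' : q ∈ I n := by rw [hn (n + 1) (Nat.le_succ n)]; exact hq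
  have hpx : x n * unop p = 0 := hp _ rfl
  have hqx : x n * unop q = 0 := hq' _ ⟨n, Set.self_mem_Ici, rfl⟩
  apply hx n
  calc x n = x n * unop (p + q) := by rw [hpq]; simp
    _ = 0 := by rw [unop_add, mul_add, hpx, hqx, add_zero]

/-- Every left ideal has a complement up to essential extension that is finitely generated. -/
theorem exists_fg_disjoint_leftEssential [IsNoetherianRing Rᵐᵒᵖ]
    (hinj : IsLeftAlephZeroInjective R) (B : Ideal R) :
    ∃ K : Ideal R, K.FG ∧ Disjoint K B ∧ LeftEssential (K ⊔ B) := by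
  by_contra! hcon
  have hstep : ∀ K : {K : Ideal R // K.FG ∧ Disjoint K B},
      ∃ x : R, x ≠ 0 ∧ Disjoint (K.1 ⊔ B) (Ideal.span {x}) := by
    rintro ⟨K, hK, hKB⟩
    have := hcon K hK hKB
    simp only [LeftEssential] at this
    push Not at this
    obtain ⟨x, hx, h⟩ := this
    refine ⟨x, hx, Submodule.disjoint_def.2 fun y hy hyx => ?_⟩
    obtain ⟨r, rfl⟩ := Ideal.mem_span_singleton'.1 hyx
    by_contra h0
    exact h r h0 hy
  choose g hg0 hgd using hstep
  let K : ℕ → {K : Ideal R // K.FG ∧ Disjoint K B} := fun n => Nat.rec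
    ⟨⊥, Submodule.fg_bot, disjoint_bot_left⟩ (fun _ K => ⟨K.1 ⊔ Ideal.span {g K},
      Submodule.FG.sup K.2.1 (Submodule.fg_span_singleton _), by
        rw [sup_comm]
        refine (Disjoint.disjoint_sup_right_of_disjoint_sup_left K.2.2.symm ?_).symm.mono_left
          (by rw [sup_comm])
        rw [sup_comm]; exact hgd K⟩) n
  have hK : ∀ n, (K (n + 1)).1 = (K n).1 ⊔ Ideal.span {g (K n)} := fun n => rfl
  have hmono : Monotone fun n => (K n).1 := monotone_nat_of_le_succ fun n => by
    rw [hK]; exact le_sup_left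
  refine not_forall_disjoint_span hinj (fun n => g (K n)) (fun n => hg0 _) fun n => ?_
  refine (hgd (K n)).mono_left (le_trans (Ideal.span_le.2 ?_) le_sup_left)
  rintro _ ⟨i, hi, rfl⟩
  have : (K (i + 1)).1 ≤ (K n).1 := hmono hi
  rw [hK] at this
  exact this (le_sup_right (a := (K i).1) (Ideal.mem_span_singleton_self _))

end

/-! ### Von Neumann regular and semiprimary rings -/

section

variable {S : Type*} [Ring S]

/-- In a left noetherian von Neumann regular ring every left ideal is generated by an idempotent:
a maximal one among those so generated has to be everything, since an element outside it yields a
larger idempotent. -/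
theorem exists_idempotent_of_regular [IsNoetherianRing S] (h : ∀ a : S, ∃ c, a * c * a = a)
    (I : Ideal S) : ∃ e ∈ I, e * e = e ∧ ∀ a ∈ I, a * e = a := by
  obtain ⟨J, ⟨e, heI, hee, rfl⟩, hmax⟩ := set_has_maximal_iff_noetherian.2
    ‹IsNoetherianRing S› {J : Ideal S | ∃ e ∈ I, e * e = e ∧ J = Ideal.span {e}}
    ⟨⊥, 0, I.zero_mem, by simp, by simp⟩
  refine ⟨e, heI, hee, fun a ha => ?_⟩
  by_contra hae
  set b := a - a * e with hb
  have hbI : b ∈ I := I.sub_mem ha (I.mul_mem_left a heI)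
  have hb0 : b ≠ 0 := fun h0 => hae (sub_eq_zero.1 h0).symm
  have hbe : b * e = 0 := by rw [hb, sub_mul, mul_assoc, hee, sub_self]
  obtain ⟨c, hc⟩ := h b
  set g := c * b with hg
  have hgI : g ∈ I := I.mul_mem_left c hbI
  have hgg : g * g = g := by rw [hg, mul_assoc, ← mul_assoc b, hc]
  have hge : g * e = 0 := by rw [hg, mul_assoc, hbe, mul_zero]
  have hbg : b * g = b := by rw [hg, ← mul_assoc, hc]
  set f := e + g - e * g with hf
  have hef : e * f = e := by
    rw [hf, mul_sub, mul_add, hee, ← mul_assoc e e, hee, add_sub_cancel_right]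
  have hgf : g * f = g := by
    rw [hf, mul_sub, mul_add, hge, hgg, ← mul_assoc g e, hge, zero_mul, zero_add, sub_zero]
  have hff : f * f = f := by
    conv_lhs => rw [hf]
    rw [sub_mul, add_mul, hef, hgf, mul_assoc, hgf]
  refine hmax _ ⟨f, I.sub_mem (I.add_mem heI hgI) (I.mul_mem_left e hgI), hff, rfl⟩ ?_
  refine lt_of_le_not_ge (Ideal.span_le.2 (Set.singleton_subset_iff.2
    (Ideal.mem_span_singleton'.2 ⟨e, hef⟩))) fun hle => ?_
  obtain ⟨r, hr⟩ := Ideal.mem_span_singleton'.1 (hle (Ideal.mem_span_singleton_self f))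
  have hfe : f * e = f := by rw [← hr, mul_assoc, hee]
  apply hb0
  rw [← hbg, ← hgf, ← hfe, ← mul_assoc g, hgf, hge, mul_zero]

theorem isSemisimpleRing_of_regular [IsNoetherianRing S] (h : ∀ a : S, ∃ c, a * c * a = a) :
    IsSemisimpleRing S := by
  refine (isSemisimpleModule_iff S S).2 ⟨fun I => ?_⟩
  obtain ⟨e, heI, hee, he⟩ := exists_idempotent_of_regular h I
  refine ⟨Ideal.span {1 - e}, Submodule.disjoint_def.2 fun x hx hx' => ?_,
    codisjoint_iff.2 ((Ideal.eq_top_iff_one _).2 ?_)⟩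
  · obtain ⟨r, rfl⟩ := Ideal.mem_span_singleton'.1 hx'
    rw [← he _ hx, mul_assoc, sub_mul, one_mul, hee, sub_self, mul_zero]
  · exact Submodule.mem_sup.2 ⟨e, heI, 1 - e, Ideal.mem_span_singleton_self _, by simp⟩

theorem le_of_isMaximal_of_isNilpotent {N M : Ideal S} (hN : ∀ x ∈ N, IsNilpotent x)
    (hM : M.IsMaximal) : N ≤ M := by
  intro x hx
  by_contra hxM
  have : M ⊔ N = ⊤ := hM.1.2 _ (lt_of_le_of_ne le_sup_left fun h =>
    hxM (h ▸ le_sup_right (a := M) hx))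
  obtain ⟨m, hm, n, hn, hmn⟩ := Submodule.mem_sup.1 ((Ideal.eq_top_iff_one _).1 this)
  have hu : IsUnit m := by
    rw [eq_sub_of_add_eq hmn]; exact (hN n hn).isUnit_one_sub
  exact hM.ne_top (Ideal.eq_top_of_isUnit_mem _ hm hu)

theorem isSemiprimaryRing_of_isNilpotent (N : Ideal S) [N.IsTwoSided] (hN : IsNilpotent N)
    [IsSemisimpleRing (S ⧸ N)] : IsSemiprimaryRing S := by
  have hle : N ≤ Ring.jacobson S := by
    rw [Ring.jacobson_eq_sInf_isMaximal]
    refine le_sInf fun M hM => le_of_isMaximal_of_isNilpotent (fun x hx => ?_) hM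
    obtain ⟨k, hk⟩ := hN
    have := Ideal.pow_mem_pow hx k
    rw [hk] at this
    exact ⟨k, this⟩
  have heq : N = Ring.jacobson S :=
    le_antisymm hle (Ring.jacobson_le_of_eq_bot (IsSemisimpleRing.jacobson_eq_bot _))
  subst heq
  exact ⟨inferInstance, hN⟩

end

/-! ### The left singular ideal -/

section

variable (R : Type*) [Ring R]

/-- The left singular ideal, the two-sided ideal of the elements whose left annihilator is an
essential left ideal, encoded as a right ideal. -/
def leftSingular : Ideal Rᵐᵒᵖ where
  carrier := {z | LeftEssential (leftAnn {z})}
  add_mem' {x y} hx hy := (hx.inf hy).mono fun a ha z hz => by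
    rw [Set.mem_singleton_iff.1 hz, unop_add, mul_add, ha.1 x rfl, ha.2 y rfl, add_zero]
  zero_mem' x hx := ⟨1, by simpa, by simp [mem_leftAnn]⟩
  smul_mem' c x hx := LeftEssential.mono hx fun a ha z hz => by
    rw [Set.mem_singleton_iff.1 hz, smul_eq_mul, unop_mul, ← mul_assoc, ha x rfl, zero_mul]

variable {R}

instance : (leftSingular R).IsTwoSided where
  mul_mem_of_left {z} c hz x hx := by
    by_cases h : x * unop c = 0
    · refine ⟨1, by simpa, fun w hw => ?_⟩
      rw [Set.mem_singleton_iff.1 hw, one_mul, unop_mul, ← mul_assoc, h, zero_mul]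
    · obtain ⟨r, hr, hr'⟩ := hz _ h
      refine ⟨r, fun h0 => hr (by rw [← mul_assoc, h0, zero_mul]), fun w hw => ?_⟩
      rw [Set.mem_singleton_iff.1 hw, unop_mul, ← hr' z rfl]
      simp only [mul_assoc]

theorem leftEssential_leftAnn_finset (F : Finset Rᵐᵒᵖ) (hF : ∀ z ∈ F, z ∈ leftSingular R) :
    LeftEssential (leftAnn (F : Set Rᵐᵒᵖ)) := by
  classical
  induction F using Finset.induction_on with
  | empty => exact fun x hx => ⟨1, by simpa, by simp [mem_leftAnn]⟩
  | insert a s _ ih =>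
    refine ((hF a (Finset.mem_insert_self a s)).inf
      (ih fun z hz => hF z (Finset.mem_insert_of_mem hz))).mono fun y hy z hz => ?_
    rcases Finset.mem_insert.1 (Finset.mem_coe.1 hz) with rfl | hz
    · exact hy.1 z rfl
    · exact hy.2 z hz

/-- The two-sided ideal of the elements that annihilate the left ideal `A` from the left,
encoded as a right ideal. -/
def leftAnnRight (A : Ideal R) : Ideal Rᵐᵒᵖ where
  carrier := {y | ∀ a ∈ A, unop y * a = 0}
  add_mem' hx hy a ha := by rw [unop_add, add_mul, hx a ha, hy a ha, add_zero]
  zero_mem' a _ := by simp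
  smul_mem' c x hx a ha := by
    rw [smul_eq_mul, unop_mul, mul_assoc, hx _ (A.mul_mem_left _ ha)]

instance (A : Ideal R) : (leftAnnRight A).IsTwoSided where
  mul_mem_of_left {y} c hy a ha := by rw [unop_mul, mul_assoc, hy a ha, mul_zero]

/-- A two-sided ideal, given as a right ideal, seen as a left ideal. -/
def toLeft (I : Ideal Rᵐᵒᵖ) [I.IsTwoSided] : Ideal R where
  carrier := {x | op x ∈ I}
  add_mem' hx hy := by simpa using I.add_mem hx hy
  zero_mem' := by simp
  smul_mem' c x hx := by simpa using I.mul_mem_right (op c) hx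

theorem mem_toLeft {I : Ideal Rᵐᵒᵖ} [I.IsTwoSided] {x : R} : x ∈ toLeft I ↔ op x ∈ I := Iff.rfl

/-- In a right noetherian ring the left singular ideal `Z` is nilpotent. The left annihilators
`L` of the powers `Zᵐ` become stationary; but `L` is essential and `Zᵐ` is finitely generated as a
right ideal, so if `Zᵐ ≠ 0` some `r` satisfies `0 ≠ r Zᵐ ⊆ L`, whence `r` annihilates `Z²ᵐ` and
not `Zᵐ`. -/
theorem isNilpotent_leftSingular [IsNoetherianRing Rᵐᵒᵖ] : IsNilpotent (leftSingular R) := by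
  classical
  set Z := leftSingular R
  let I : ℕ →o Ideal Rᵐᵒᵖ := ⟨fun n => leftAnnRight (toLeft (Z ^ n)), fun m n h y hy a ha =>
    hy a (Ideal.pow_le_pow_right h ha)⟩
  obtain ⟨n, hn⟩ := monotone_stabilizes_iff_noetherian.2 ‹IsNoetherianRing Rᵐᵒᵖ› I
  set m := n + 1 with hm
  have hI : I m = I (m + m) := by rw [← hn m (by omega), ← hn (m + m) (by omega)]
  refine ⟨m, ?_⟩
  by_contra hZ
  obtain ⟨F, hF⟩ := (isNoetherianRing_iff_ideal_fg _).1 ‹IsNoetherianRing Rᵐᵒᵖ› (Z ^ m)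
  have hann : leftAnn ((Z ^ m : Ideal Rᵐᵒᵖ) : Set Rᵐᵒᵖ) = leftAnn (F : Set Rᵐᵒᵖ) := by
    rw [← leftAnn_span (F : Set Rᵐᵒᵖ), hF]
  have hFZ : ∀ z ∈ F, z ∈ Z := fun z hz =>
    Ideal.pow_le_self (n := m) (by omega) (hF ▸ Ideal.subset_span hz)
  have hess := leftEssential_leftAnn_finset F hFZ
  have hne : ∃ f ∈ F, f ≠ 0 := by
    by_contra! h0
    refine hZ ?_
    rw [Submodule.zero_eq_bot, ← hF, Ideal.span_eq_bot]
    exact h0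
  obtain ⟨f, hfF, hf0⟩ := hne
  obtain ⟨r, hr, y, hy, hry⟩ := hess.exists_mul_finset (F.image unop)
    (Finset.mem_image_of_mem _ hfF) (by simpa using hf0)
  obtain ⟨g, hg, rfl⟩ := Finset.mem_image.1 hy
  have hrW : ∀ w ∈ Z ^ m, r * unop w ∈ leftAnn ((Z ^ m : Ideal Rᵐᵒᵖ) : Set Rᵐᵒᵖ) := by
    intro w hw
    rw [← hF] at hw
    induction hw using Submodule.span_induction with
    | mem w hw => rw [hann]; exact hr _ (Finset.mem_image_of_mem _ hw)
    | zero => simp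
    | add x y _ _ hx hy => rw [unop_add, mul_add]; exact Ideal.add_mem _ hx hy
    | smul c x _ hx =>
      intro v hv
      have := hx (v * c) (Ideal.mul_mem_right c _ hv)
      rw [unop_mul] at this
      rw [smul_eq_mul, unop_mul, ← this]
      simp only [mul_assoc]
  have hrI : op r ∈ I (m + m) := by
    intro a ha
    rw [mem_toLeft, Ideal.IsTwoSided.pow_add] at ha
    suffices h : ∀ w ∈ Z ^ m * Z ^ m, r * unop w = 0 from h _ ha
    intro w hw
    induction hw using Submodule.mul_induction_on' with
    | mem_mul_mem u hu v hv => rw [unop_mul, ← mul_assoc]; exact hrW v hv u hu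
    | add x _ y _ hx hy => rw [unop_add, mul_add, hx, hy, add_zero]
  rw [← hI] at hrI
  exact hry (hrI (unop g) (by rw [mem_toLeft, op_unop, ← hF]; exact Ideal.subset_span hg))

/-- `R` modulo its left singular ideal is von Neumann regular. If `K` is finitely generated and
complements `leftAnn {a}` up to essential extension, the inverse `K a → K` of right multiplication
by `a` is right multiplication by some `c`, and `K ⊔ leftAnn {a}` annihilates `a - a c a`. -/
theorem exists_sub_mem_leftSingular [IsNoetherianRing Rᵐᵒᵖ] (hinj : IsLeftAlephZeroInjective R)
    (a : R) : ∃ c : R, op (a - a * c * a) ∈ leftSingular R := by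
  obtain ⟨K, hK, hd, hess⟩ := exists_fg_disjoint_leftEssential hinj (leftAnn {op a})
  let u : K →ₗ[R] R := LinearMap.toSpanSingleton R R a ∘ₗ K.subtype
  have hr : (LinearMap.range u).FG := by
    rw [LinearMap.range_comp, Submodule.range_subtype]
    exact Submodule.FG.map _ hK
  obtain ⟨c, hc⟩ := (hinj.mapsAreRightMul_of_fg hr).exists_eq_mul (u := u) (v := K.subtype) (by
    intro k hk
    refine Submodule.disjoint_def.1 hd _ k.2 fun z hz => ?_
    rw [Set.mem_singleton_iff.1 hz]; exact hk)
  refine ⟨c, LeftEssential.mono hess (sup_le (fun k hk z hz => ?_) fun y hy z hz => ?_)⟩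
  · have h := hc ⟨k, hk⟩
    have h : k = k * a * c := h
    rw [Set.mem_singleton_iff.1 hz, unop_op, mul_sub, ← mul_assoc, ← mul_assoc, ← h, sub_self]
  · have h : y * a = 0 := hy _ rfl
    rw [Set.mem_singleton_iff.1 hz, unop_op, mul_sub, ← mul_assoc, ← mul_assoc, h]
    simp

theorem isSemisimpleRing_quotient_leftSingular [IsNoetherianRing Rᵐᵒᵖ]
    (hinj : IsLeftAlephZeroInjective R) : IsSemisimpleRing (Rᵐᵒᵖ ⧸ leftSingular R) := by
  have : IsNoetherianRing (Rᵐᵒᵖ ⧸ leftSingular R) :=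
    isNoetherianRing_of_surjective _ _ (Ideal.Quotient.mk (leftSingular R))
      Ideal.Quotient.mk_surjective
  refine isSemisimpleRing_of_regular fun x => ?_
  obtain ⟨a, rfl⟩ := Ideal.Quotient.mk_surjective x
  obtain ⟨c, hc⟩ := exists_sub_mem_leftSingular hinj (unop a)
  refine ⟨Ideal.Quotient.mk _ (op c), ?_⟩
  rw [← map_mul, ← map_mul, eq_comm, Ideal.Quotient.mk_eq_mk_iff_sub_mem]
  simpa [mul_assoc] using hc

theorem isArtinianRing_op [IsNoetherianRing Rᵐᵒᵖ] (hinj : IsLeftAlephZeroInjective R) :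
    IsArtinianRing Rᵐᵒᵖ := by
  have := isSemisimpleRing_quotient_leftSingular hinj
  have := isSemiprimaryRing_of_isNilpotent (leftSingular R) isNilpotent_leftSingular
  exact IsSemiprimaryRing.isNoetherian_iff_isArtinian.1 ‹IsNoetherianRing Rᵐᵒᵖ›

/-- Left ideals are generated by an idempotent modulo the left singular ideal. -/
theorem exists_mem_sub_mul_mem_leftSingular [IsNoetherianRing Rᵐᵒᵖ]
    (hinj : IsLeftAlephZeroInjective R) (A : Ideal R) :
    ∃ e ∈ A, ∀ a ∈ A, op (a - a * e) ∈ leftSingular R := by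
  have := isSemisimpleRing_quotient_leftSingular hinj
  let g : R →+* (Rᵐᵒᵖ ⧸ leftSingular R)ᵐᵒᵖ :=
    (RingHom.op (Ideal.Quotient.mk (leftSingular R))).comp (RingEquiv.opOp R).toRingHom
  have hgv : ∀ r, g r = op (Ideal.Quotient.mk (leftSingular R) (op r)) := fun _ => rfl
  have hg : Function.Surjective g := fun y => by
    obtain ⟨x, hx⟩ := Ideal.Quotient.mk_surjective (unop y)
    exact ⟨unop x, by rw [hgv, op_unop, hx, op_unop]⟩
  obtain ⟨e, he, hAe⟩ := IsSemisimpleRing.ideal_eq_span_idempotent (A.map g)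
  obtain ⟨x, hx, rfl⟩ := (Ideal.mem_map_iff_of_surjective g hg).1
    (hAe ▸ Ideal.mem_span_singleton_self e)
  refine ⟨x, hx, fun a ha => ?_⟩
  obtain ⟨r, hr⟩ := Ideal.mem_span_singleton'.1 (hAe ▸ Ideal.mem_map_of_mem g ha)
  have : g (a - a * x) = 0 := by
    rw [map_sub, map_mul, ← hr, mul_assoc, he.eq, sub_self]
  rw [hgv, op_eq_zero_iff] at this
  exact Ideal.Quotient.eq_zero_iff_mem.1 this

end

/-! ### Left self-injectivity and right ideals as annihilators -/

section

variable {R : Type*} [Ring R]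

/-- By the descending chain condition, a right annihilator is that of a finitely generated left
ideal. -/
theorem exists_fg_le_rightAnn_eq [IsArtinianRing Rᵐᵒᵖ] (A : Ideal R) :
    ∃ B ≤ A, B.FG ∧ rightAnn (B : Set R) = rightAnn (A : Set R) := by
  obtain ⟨J, ⟨B, hBA, hB, rfl⟩, hmin⟩ := IsArtinian.set_has_minimal
    {J : Ideal Rᵐᵒᵖ | ∃ B ≤ A, B.FG ∧ rightAnn (B : Set R) = J}
    ⟨_, ⊥, bot_le, Submodule.fg_bot, rfl⟩
  refine ⟨B, hBA, hB, le_antisymm (fun x hx a ha => ?_) (rightAnn_anti hBA)⟩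
  have hle : rightAnn ((B ⊔ Ideal.span {a} : Ideal R) : Set R) ≤ rightAnn (B : Set R) :=
    rightAnn_anti (le_sup_left (a := B))
  have hge := not_lt_iff_le_imp_ge.1 (hmin _ ⟨B ⊔ Ideal.span {a},
    sup_le hBA ((Ideal.span_singleton_le_iff_mem A).2 ha),
    Submodule.FG.sup hB (Submodule.fg_span_singleton a), rfl⟩) hle
  exact hge hx a (le_sup_right (a := B) (Ideal.mem_span_singleton_self a))

/-- Maps on a finitely generated `B ≤ A` with the same right annihilator as `A` determine maps
on `A`. -/
theorem IsLeftAlephZeroInjective.mapsAreRightMul_of_isArtinianRing [IsArtinianRing Rᵐᵒᵖ]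
    (hinj : IsLeftAlephZeroInjective R) (A : Ideal R) : MapsAreRightMul A := by
  intro f
  obtain ⟨B, hBA, hB, hann⟩ := exists_fg_le_rightAnn_eq A
  obtain ⟨c, hc⟩ := hinj.mapsAreRightMul_of_fg hB (f ∘ₗ Submodule.inclusion hBA)
  refine ⟨c, fun a => ?_⟩
  have hle : B ⊔ Ideal.span {(a : R)} ≤ A :=
    sup_le hBA ((Ideal.span_singleton_le_iff_mem A).2 a.2)
  obtain ⟨d, hd⟩ := hinj.mapsAreRightMul_of_fg
    (Submodule.FG.sup hB (Submodule.fg_span_singleton (a : R))) (f ∘ₗ Submodule.inclusion hle)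
  have hmem : op (c - d) ∈ rightAnn (A : Set R) := by
    rw [← hann]
    intro b hb
    have h1 : f ⟨b, hBA hb⟩ = b * c := hc ⟨b, hb⟩
    have h2 : f ⟨b, hBA hb⟩ = b * d := hd ⟨b, le_sup_left (a := B) hb⟩
    rw [unop_op, mul_sub, ← h1, ← h2, sub_self]
  have h3 : f a = a * d := hd ⟨a, le_sup_right (a := B) (Ideal.mem_span_singleton_self (a : R))⟩
  have h4 : (a : R) * (c - d) = 0 := hmem a a.2
  rw [h3, ← sub_eq_zero, ← mul_sub, ← neg_sub c d, mul_neg, h4, neg_zero]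

theorem rightAnn_sup (A B : Ideal R) : rightAnn ((A ⊔ B : Ideal R) : Set R) =
    rightAnn (A : Set R) ⊓ rightAnn (B : Set R) := by
  refine le_antisymm (le_inf (rightAnn_anti (le_sup_left (a := A)))
    (rightAnn_anti (le_sup_right (a := A)))) fun x hx y hy => ?_
  obtain ⟨a, ha, b, hb, rfl⟩ := Submodule.mem_sup.1 hy
  rw [add_mul, hx.1 a ha, hx.2 b hb, add_zero]

theorem leftAnn_sup (I J : Ideal Rᵐᵒᵖ) : leftAnn ((I ⊔ J : Ideal Rᵐᵒᵖ) : Set Rᵐᵒᵖ) =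
    leftAnn (I : Set Rᵐᵒᵖ) ⊓ leftAnn (J : Set Rᵐᵒᵖ) := by
  refine le_antisymm (le_inf (leftAnn_anti (le_sup_left (a := I)))
    (leftAnn_anti (le_sup_right (a := I)))) fun x hx y hy => ?_
  obtain ⟨a, ha, b, hb, rfl⟩ := Submodule.mem_sup.1 hy
  rw [unop_add, mul_add, hx.1 a ha, hx.2 b hb, add_zero]

theorem rightAnn_inf (h : ∀ A : Ideal R, MapsAreRightMul A) (A B : Ideal R) :
    rightAnn ((A ⊓ B : Ideal R) : Set R) = rightAnn (A : Set R) ⊔ rightAnn (B : Set R) :=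
  le_antisymm (h _).rightAnn_inf_le (sup_le (rightAnn_anti (inf_le_left (a := A)))
    (rightAnn_anti (inf_le_right (a := A))))

theorem rightAnn_inf_leftAnn [IsNoetherianRing Rᵐᵒᵖ] (h : ∀ A : Ideal R, MapsAreRightMul A)
    (A : Ideal R) (I : Ideal Rᵐᵒᵖ) :
    rightAnn ((A ⊓ leftAnn (I : Set Rᵐᵒᵖ) : Ideal R) : Set R) = rightAnn (A : Set R) ⊔ I := by
  induction I, IsNoetherian.noetherian I using Submodule.fg_induction generalizing A with
  | singleton x =>
    refine le_antisymm (fun y hy => ?_) (sup_le (rightAnn_anti inf_le_left) fun y hy a ha =>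
      ha.2 y hy)
    let u : A →ₗ[R] R := LinearMap.toSpanSingleton R R (unop x) ∘ₗ A.subtype
    let v : A →ₗ[R] R := LinearMap.toSpanSingleton R R (unop y) ∘ₗ A.subtype
    obtain ⟨c, hc⟩ := (h (LinearMap.range u)).exists_eq_mul (u := u) (v := v) (by
      rintro ⟨a, ha⟩ h0
      refine hy a ⟨ha, ?_⟩
      change a ∈ leftAnn ((Ideal.span {x} : Ideal Rᵐᵒᵖ) : Set Rᵐᵒᵖ)
      rw [leftAnn_span]
      intro z hz
      rw [Set.mem_singleton_iff.1 hz]; exact h0)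
    refine Submodule.mem_sup.2 ⟨y - op c * x, fun a ha => ?_, op c * x,
      Ideal.mul_mem_left _ _ (Ideal.mem_span_singleton_self x), by simp⟩
    have hca : a * unop y = a * unop x * c := hc ⟨a, ha⟩
    rw [unop_sub, unop_mul, unop_op, mul_sub, hca, mul_assoc, sub_self]
  | sup I J _ _ hI hJ => rw [leftAnn_sup, ← inf_assoc, hJ, hI, sup_assoc]

/-- Every right ideal is a right annihilator. -/
theorem rightAnn_leftAnn [IsNoetherianRing Rᵐᵒᵖ] (h : ∀ A : Ideal R, MapsAreRightMul A)
    (I : Ideal Rᵐᵒᵖ) : rightAnn (leftAnn (I : Set Rᵐᵒᵖ) : Set R) = I := by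
  have htop : rightAnn ((⊤ : Ideal R) : Set R) = ⊥ := by
    refine le_bot_iff.1 fun x hx => ?_
    have := hx 1 trivial
    rw [one_mul, unop_eq_zero_iff] at this
    exact this
  have := rightAnn_inf_leftAnn h ⊤ I
  rwa [top_inf_eq, htop, bot_sup_eq] at this

/-! ### The left socle -/

/-- The two-sided ideal of the elements annihilated by the right ideal `I` from the left,
encoded as a left ideal. -/
def rightAnnLeft (I : Ideal Rᵐᵒᵖ) : Ideal R where
  carrier := {x | ∀ i ∈ I, unop i * x = 0}
  add_mem' hx hy i hi := by rw [mul_add, hx i hi, hy i hi, add_zero]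
  zero_mem' i _ := by simp
  smul_mem' c x hx i hi := by
    rw [smul_eq_mul, ← mul_assoc]; exact hx _ (I.mul_mem_left (op c) hi)

theorem rightAnnLeft_anti {I J : Ideal Rᵐᵒᵖ} (h : I ≤ J) : rightAnnLeft J ≤ rightAnnLeft I :=
  fun _ hx i hi => hx i (h hi)

theorem rightAnnLeft_sup (I J : Ideal Rᵐᵒᵖ) :
    rightAnnLeft (I ⊔ J) = rightAnnLeft I ⊓ rightAnnLeft J := by
  refine le_antisymm (le_inf (rightAnnLeft_anti le_sup_left) (rightAnnLeft_anti le_sup_right))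
    fun x hx y hy => ?_
  obtain ⟨a, ha, b, hb, rfl⟩ := Submodule.mem_sup.1 hy
  rw [unop_add, add_mul, hx.1 a ha, hx.2 b hb, add_zero]

theorem rightAnnLeft_leftAnnRight [IsNoetherianRing Rᵐᵒᵖ]
    (h : ∀ A : Ideal R, MapsAreRightMul A) (B : Ideal R) [B.IsTwoSided] :
    rightAnnLeft (leftAnnRight B) = B := by
  refine le_antisymm (fun x hx => ?_) fun x hx y hy => hy x hx
  let I : Ideal Rᵐᵒᵖ :=
    { carrier := {x | unop x ∈ B}
      add_mem' := fun hx hy => B.add_mem hx hy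
      zero_mem' := B.zero_mem
      smul_mem' := fun c x hx => B.mul_mem_right (unop c) hx }
  have : op x ∈ I := by
    rw [← rightAnn_leftAnn h I]
    exact fun y hy => hx (op y) fun b hb => hy (op b) hb
  exact this

theorem leftEssential_rightAnnLeft_leftSingular [IsNoetherianRing Rᵐᵒᵖ] :
    LeftEssential (rightAnnLeft (leftSingular R)) := by
  classical
  intro x hx
  have hex : ∃ k : ℕ, ∀ z ∈ leftSingular R ^ k, unop z * x = 0 := by
    obtain ⟨k, hk⟩ := isNilpotent_leftSingular (R := R)
    refine ⟨k, fun z hz => ?_⟩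
    rw [hk] at hz
    rw [(Submodule.mem_bot _).1 hz, unop_zero, zero_mul]
  have hk := Nat.find_spec hex
  obtain ⟨k, hk'⟩ : ∃ k, Nat.find hex = k + 1 := Nat.exists_eq_succ_of_ne_zero fun h0 => by
    rw [h0, Submodule.pow_zero, Ideal.one_eq_top] at hk
    exact hx (by simpa using hk 1 trivial)
  have hmin := Nat.find_min hex (m := k) (by omega)
  push Not at hmin
  obtain ⟨z, hz, hzx⟩ := hmin
  refine ⟨unop z, hzx, fun w hw => ?_⟩
  rw [← mul_assoc, ← unop_mul]
  refine hk _ ?_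
  rw [hk', Ideal.IsTwoSided.pow_add, Submodule.pow_one]
  exact Ideal.mul_mem_mul hz hw

/-- The right annihilator of the left socle is the left singular ideal. -/
theorem rightAnn_rightAnnLeft_leftSingular [IsNoetherianRing Rᵐᵒᵖ]
    (hinj : IsLeftAlephZeroInjective R) :
    rightAnn (rightAnnLeft (leftSingular R) : Set R) = leftSingular R := by
  refine le_antisymm (fun c hc => ?_) fun c hc y hy => ?_
  · refine leftEssential_rightAnnLeft_leftSingular.mono fun y hy z hz => ?_
    rw [Set.mem_singleton_iff.1 hz]; exact hc y hy
  · obtain ⟨e, he, hA⟩ := exists_mem_sub_mul_mem_leftSingular hinj (leftAnn {op (y * unop c)})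
    have he : e * (y * unop c) = 0 := he _ rfl
    have hZ : ∀ r, op r ∈ leftSingular R → r * y = 0 := fun r hr => hy _ hr
    have hny : (1 - e) * y = 0 := by
      by_contra hne
      -- `s` moves `(1 - e) * y` into the essential left ideal `leftAnn {c}`
      obtain ⟨s, hs, hsc⟩ := hc _ hne
      have hsc : s * ((1 - e) * y) * unop c = 0 := hsc c rfl
      have h1 := hA (s * (1 - e)) fun z hz => by
        rw [Set.mem_singleton_iff.1 hz, unop_op, ← hsc]; simp only [mul_assoc]
      have h2 : op (s * (1 - e) * e) ∈ leftSingular R := by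
        have := hA e fun z hz => by rw [Set.mem_singleton_iff.1 hz]; exact he
        have := Ideal.mul_mem_right (op s) _ this
        rw [← op_mul] at this
        convert this using 2
        noncomm_ring
      refine hs ?_
      rw [← mul_assoc]
      refine hZ _ ?_
      have := Ideal.add_mem _ h1 h2
      rwa [← op_add, sub_add_cancel] at this
    rw [sub_mul, one_mul, sub_eq_zero] at hny
    rw [hny, mul_assoc, he]

end

/-- A noetherian argument, as for surjective endomorphisms of noetherian modules: a map that
preserves suprema and fixes `z`, and is surjective onto a part of the lattice lying above `z`,
sends only `z` to `z` within that part. -/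
theorem eq_of_map_eq_of_wellFoundedGT {L : Type*} [SemilatticeSup L] [WellFoundedGT L] {z : L}
    {φ : L → L} (hsup : ∀ a b, φ (a ⊔ b) = φ a ⊔ φ b) (hz : φ z = z) {P : L → Prop}
    (hP : ∀ a, P a → z ≤ a) (hsurj : ∀ a, P a → ∃ b, P b ∧ φ b = a) {k : L} (hk : P k)
    (hkz : φ k = z) : k = z := by
  have hsup' : ∀ n a b, φ^[n] (a ⊔ b) = φ^[n] a ⊔ φ^[n] b := by
    intro n
    induction n with
    | zero => exact fun _ _ => rfl
    | succ n ih => intro a b; rw [Function.iterate_succ_apply, hsup, ih]; rfl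
  have hmono : ∀ n, Monotone φ^[n] := fun n a b hab => by
    rw [← sup_eq_right] at hab ⊢
    rw [← hsup', hab]
  have hsurj' : ∀ n, ∃ a, P a ∧ φ^[n] a = k := by
    intro n
    induction n with
    | zero => exact ⟨k, hk, rfl⟩
    | succ n ih =>
      obtain ⟨a, ha, hak⟩ := ih
      obtain ⟨b, hb, rfl⟩ := hsurj a ha
      exact ⟨b, hb, by rwa [Function.iterate_succ_apply]⟩
  obtain ⟨m, ⟨n, hn⟩, hmax⟩ := wellFounded_gt.has_min {a : L | ∃ n, φ^[n] a = z} ⟨z, 0, rfl⟩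
  obtain ⟨a, ha, hak⟩ := hsurj' n
  have ham : φ^[n + 1] (a ⊔ m) = z := by
    rw [hsup', Function.iterate_succ_apply', Function.iterate_succ_apply', hak, hn, hkz, hz,
      sup_idem]
  have hle : a ≤ m := by
    by_contra h
    exact hmax _ ⟨n + 1, ham⟩ (right_lt_sup.2 h)
  exact le_antisymm (hak ▸ hn ▸ hmono n hle) (hP k hk)

section

variable {R : Type*} [Ring R]

/-- The left annihilator of the left socle is the left singular ideal `Z`. On right ideals above
`Z`, taking the right annihilator twice preserves suprema, is surjective onto two-sided ideals,
and sends both `Z` and this left annihilator to `Z`. -/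
theorem leftAnnRight_rightAnnLeft_leftSingular [IsNoetherianRing Rᵐᵒᵖ]
    (hinj : IsLeftAlephZeroInjective R) (h : ∀ A : Ideal R, MapsAreRightMul A) :
    leftAnnRight (rightAnnLeft (leftSingular R)) = leftSingular R := by
  have hZ := rightAnn_rightAnnLeft_leftSingular hinj
  have hle : leftSingular R ≤ leftAnnRight (rightAnnLeft (leftSingular R)) :=
    fun z hz a ha => ha z hz
  refine eq_of_map_eq_of_wellFoundedGT
    (φ := fun I : Ideal Rᵐᵒᵖ => rightAnn (rightAnnLeft I : Set R))
    (fun I J => by rw [rightAnnLeft_sup, rightAnn_inf h]) hZ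
    (P := fun I => I.IsTwoSided ∧ leftSingular R ≤ I) (fun I hI => hI.2) (fun I hI => ?_)
    ⟨inferInstance, hle⟩ ?_
  · have := hI.1
    let B : Ideal R := rightAnnLeft (leftSingular R) ⊓ leftAnn (I : Set Rᵐᵒᵖ)
    have hB : B.IsTwoSided := ⟨fun {a} b ha => ⟨fun i hi => by
      rw [← mul_assoc, ha.1 i hi, zero_mul], fun x hx => by
      rw [mul_assoc]; exact ha.2 (x * op b) (I.mul_mem_right _ hx)⟩⟩
    refine ⟨leftAnnRight B, ⟨inferInstance, fun z hz b hb => hb.1 z hz⟩, ?_⟩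
    simp only [rightAnnLeft_leftAnnRight h B]
    rw [rightAnn_inf_leftAnn h, hZ]
    exact sup_eq_right.2 hI.2
  · have : rightAnnLeft (leftAnnRight (rightAnnLeft (leftSingular R))) =
        rightAnnLeft (leftSingular R) :=
      le_antisymm (rightAnnLeft_anti hle) fun x hx y hy => hy x hx
    simp only [this]
    exact hZ

/-- Every simple left module embeds in `R`. -/
theorem exists_ne_zero_of_isMaximal [IsNoetherianRing Rᵐᵒᵖ]
    (hinj : IsLeftAlephZeroInjective R) (h : ∀ A : Ideal R, MapsAreRightMul A) {M : Ideal R}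
    (hM : M.IsMaximal) : ∃ x : R, x ≠ 0 ∧ ∀ m ∈ M, m * x = 0 := by
  by_contra! hcon
  obtain ⟨e, he, hMe⟩ := exists_mem_sub_mul_mem_leftSingular hinj M
  have h1 : op (1 - e) ∈ leftSingular R := by
    rw [← leftAnnRight_rightAnnLeft_leftSingular hinj h]
    intro s hs
    by_contra hne
    obtain ⟨m, hm, hm0⟩ := hcon _ hne
    refine hm0 ?_
    have := hs _ (hMe m hm)
    rwa [unop_op, ← mul_one_sub, mul_assoc] at this
  have h2 : toLeft (leftSingular R) ≤ M := le_of_isMaximal_of_isNilpotent (fun x hx => by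
    obtain ⟨k, hk⟩ := isNilpotent_leftSingular (R := R)
    have := Ideal.pow_mem_pow (mem_toLeft.1 hx) k
    rw [hk] at this
    exact ⟨k, op_injective (by simpa using this)⟩) hM
  exact hM.ne_top ((Ideal.eq_top_iff_one _).2 (by
    simpa using M.add_mem (h2 (mem_toLeft.2 h1)) he))

/-! ### Left ideals as annihilators and right self-injectivity -/

/-- Every left ideal is a left annihilator: if `b ∉ A`, then `(A + R b) / A` has a simple quotient,
which embeds in `R`, and the resulting map `A + R b → R` is a right multiplication. -/
theorem leftAnn_rightAnn [IsNoetherianRing Rᵐᵒᵖ]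
    (hinj : IsLeftAlephZeroInjective R) (h : ∀ A : Ideal R, MapsAreRightMul A) (A : Ideal R) :
    leftAnn (rightAnn (A : Set R) : Set Rᵐᵒᵖ) = A := by
  refine le_antisymm (fun b hb => ?_) fun a ha x hx => hx a ha
  by_contra hbA
  have hcomap : Submodule.comap (LinearMap.toSpanSingleton R R b) A ≠ ⊤ := fun htop =>
    hbA (by simpa using (htop ▸ trivial :
      (1 : R) ∈ Submodule.comap (LinearMap.toSpanSingleton R R b) A))
  obtain ⟨M, hM, hle⟩ := Ideal.exists_le_maximal _ hcomap
  obtain ⟨x, hx, hMx⟩ := exists_ne_zero_of_isMaximal hinj h hM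
  let u : (A × R) →ₗ[R] R := A.subtype.coprod (LinearMap.toSpanSingleton R R b)
  let v : (A × R) →ₗ[R] R := LinearMap.toSpanSingleton R R x ∘ₗ LinearMap.snd R A R
  obtain ⟨c, hc⟩ := (h (LinearMap.range u)).exists_eq_mul (u := u) (v := v) (by
    rintro ⟨a, s⟩ h0
    have h0 : (a : R) + s * b = 0 := h0
    refine hMx s (hle ?_)
    change s * b ∈ A
    rw [← neg_eq_of_add_eq_zero_right h0]
    exact A.neg_mem a.2)
  have hcA : op c ∈ rightAnn (A : Set R) := fun a ha => by
    simpa [u, v] using (hc (⟨a, ha⟩, 0)).symm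
  have h1 : x = b * c := by simpa [u, v] using hc (0, 1)
  exact hx (h1.trans (hb _ hcA))

theorem isNoetherianRing_of_leftAnn_rightAnn [IsArtinianRing Rᵐᵒᵖ]
    (h : ∀ A : Ideal R, leftAnn (rightAnn (A : Set R) : Set Rᵐᵒᵖ) = A) : IsNoetherianRing R := by
  refine (isNoetherian_iff' (R := R) (M := R)).2 (StrictAnti.wellFoundedGT
    (f := fun A : Ideal R => rightAnn (A : Set R)) fun A B hAB => ?_)
  refine lt_of_le_of_ne (rightAnn_anti hAB.le) fun heq => hAB.ne ?_
  simp only at heq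
  rw [← h A, ← h B, heq]

theorem leftAnn_inf (hl : ∀ A : Ideal R, leftAnn (rightAnn (A : Set R) : Set Rᵐᵒᵖ) = A)
    (hr : ∀ I : Ideal Rᵐᵒᵖ, rightAnn (leftAnn (I : Set Rᵐᵒᵖ) : Set R) = I) (I J : Ideal Rᵐᵒᵖ) :
    leftAnn ((I ⊓ J : Ideal Rᵐᵒᵖ) : Set Rᵐᵒᵖ) =
      leftAnn (I : Set Rᵐᵒᵖ) ⊔ leftAnn (J : Set Rᵐᵒᵖ) := by
  rw [← hl (leftAnn (I : Set Rᵐᵒᵖ) ⊔ leftAnn (J : Set Rᵐᵒᵖ)), rightAnn_sup, hr, hr]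

/-- The Ikeda–Nakayama argument: the double annihilator conditions make a right noetherian ring
right self-injective. -/
theorem baer_op [IsNoetherianRing Rᵐᵒᵖ]
    (hl : ∀ A : Ideal R, leftAnn (rightAnn (A : Set R) : Set Rᵐᵒᵖ) = A)
    (hr : ∀ I : Ideal Rᵐᵒᵖ, rightAnn (leftAnn (I : Set Rᵐᵒᵖ) : Set R) = I) :
    Module.Baer Rᵐᵒᵖ R := by
  intro I g
  suffices hc : ∃ c : R, ∀ x : I, g x = c * unop (x : Rᵐᵒᵖ) by
    obtain ⟨c, hc⟩ := hc
    exact ⟨LinearMap.toSpanSingleton Rᵐᵒᵖ R c, fun x hx => (hc ⟨x, hx⟩).symm⟩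
  induction I, IsNoetherian.noetherian I using Submodule.fg_induction with
  | singleton x =>
    let x' : Submodule.span Rᵐᵒᵖ {x} := ⟨x, Submodule.mem_span_singleton_self x⟩
    have hg : g x' ∈ Ideal.span {unop x} := by
      rw [← hl (Ideal.span {unop x}), rightAnn_span]
      intro t ht
      have h0 : t • x' = 0 := Subtype.ext (unop_injective (ht _ rfl))
      rw [← op_smul_eq_mul, op_unop, ← map_smul, h0, map_zero]
    obtain ⟨c, hc⟩ := Ideal.mem_span_singleton'.1 hg
    refine ⟨c, fun ⟨y, hy⟩ => ?_⟩
    obtain ⟨r, rfl⟩ := Submodule.mem_span_singleton.1 hy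
    have : (⟨r • x, hy⟩ : Submodule.span Rᵐᵒᵖ {x}) = r • x' := rfl
    rw [this, map_smul, ← hc, ← op_unop r, op_smul_eq_mul, mul_assoc]
    rfl
  | sup I J _ _ hI hJ =>
    obtain ⟨c, hc⟩ := hI (g ∘ₗ Submodule.inclusion le_sup_left)
    obtain ⟨d, hd⟩ := hJ (g ∘ₗ Submodule.inclusion le_sup_right)
    have hcd : c - d ∈ leftAnn ((I ⊓ J : Ideal Rᵐᵒᵖ) : Set Rᵐᵒᵖ) := by
      intro x hx
      have h1 : g ⟨x, le_sup_left (a := I) hx.1⟩ = c * unop x := hc ⟨x, hx.1⟩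
      have h2 : g ⟨x, le_sup_left (a := I) hx.1⟩ = d * unop x := hd ⟨x, hx.2⟩
      rw [sub_mul, ← h1, ← h2, sub_self]
    rw [leftAnn_inf hl hr] at hcd
    obtain ⟨p, hp, q, hq, hpq⟩ := Submodule.mem_sup.1 hcd
    refine ⟨c - p, fun ⟨y, hy⟩ => ?_⟩
    obtain ⟨i, hi, j, hj, rfl⟩ := Submodule.mem_sup.1 hy
    have h1 : g ⟨i, le_sup_left (a := I) hi⟩ = c * unop i := hc ⟨i, hi⟩
    have h2 : g ⟨j, le_sup_right (a := I) hj⟩ = d * unop j := hd ⟨j, hj⟩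
    have h3 : (⟨i + j, hy⟩ : (I ⊔ J : Ideal Rᵐᵒᵖ)) =
      ⟨i, le_sup_left (a := I) hi⟩ + ⟨j, le_sup_right (a := I) hj⟩ := rfl
    have h4 : p * unop i = 0 := hp i hi
    have h5 : c - p = d + q := by rw [sub_eq_iff_eq_add', ← add_assoc, add_right_comm, hpq]; simp
    have h6 : q * unop j = 0 := hq j hj
    change g ⟨i + j, hy⟩ = (c - p) * unop (i + j)
    rw [h3, map_add, h1, h2, unop_add, mul_add, sub_mul, h4, sub_zero, h5, add_mul, h6, add_zero]

/-- `R` and `Rᵐᵒᵖ` agree as right `R`-modules. -/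
def unopLinearEquiv (R : Type*) [Ring R] : Rᵐᵒᵖ ≃ₗ[Rᵐᵒᵖ] R where
  toFun := unop
  invFun := op
  map_add' _ _ := rfl
  map_smul' _ _ := rfl
  left_inv _ := rfl
  right_inv _ := rfl

end

theorem theorem14 {R : Type*} [Ring R] (hnoeth : IsNoetherian Rᵐᵒᵖ R)
    (hinj : IsLeftAlephZeroInjective R) : IsQuasiFrobenius R := by
  have : IsNoetherianRing Rᵐᵒᵖ := isNoetherian_of_linearEquiv (unopLinearEquiv R).symm
  have := isArtinianRing_op hinj
  have hmul := hinj.mapsAreRightMul_of_isArtinianRing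
  have hl := leftAnn_rightAnn hinj hmul
  refine ⟨isNoetherianRing_of_leftAnn_rightAnn hl, hnoeth, Module.Baer.injective fun A f => ?_,
    (baer_op hl (rightAnn_leftAnn hmul)).injective⟩
  obtain ⟨c, hc⟩ := hmul A f
  exact ⟨LinearMap.toSpanSingleton R R c, fun x hx => (hc ⟨x, hx⟩).symm⟩
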